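/- Let $K\subset\mathbb{R}^d$ ($d\ge 1$) be a non-empty compact set of positive volume, and let $B(x,r)$ denote the ball of centre $x$ and radius $r$. Let $s>0$ be such that the boundary $\partial K$ has finite and positive $s$-dimensional lower and upper Minkowski contents, i.e. $$0<\liminf_{r\to0+}\frac{\mathrm{Vol}(\partial K+B(0,r))}{r^{d-s}}\le\limsup_{r\to0+}\frac{\mathrm{Vol}(\partial K+B(0,r))}{r^{d-s}}<\infty$$ (so that $s$ is the Minkowski dimension of $\partial K$). Suppose that $K$ is bi-standard with constant $\varepsilon>0$: for all small enough $r>0$, $$\frac{\mathrm{Vol}(K\cap B(x,r))}{\mathrm{Vol}(B(x,r))}\ge\varepsilon\ \text{ for all } x\in K,\qquad \frac{\mathrm{Vol}(K^c\cap B(x,r))}{\mathrm{Vol}(B(x,r))}\ge\varepsilon\ \text{ for all } x\in K^c.$$ For $\lambda>0$ let $\chi_\lambda$ be a homogeneous Poisson point process of intensity $\lambda$ on $\mathbb{R}^d$, and for a locally finite set $\chi$ let $$K_{\chi}=\bigcup_{x\in\chi\cap K}\{y\in\mathbb{R}^d:\ |y-x|\le|y-x'|\text{ for all }x'\in\chi\}$$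 be the Voronoi approximation of $K$. Let $d_H$ be the Hausdorff distance (with values in $[0,\infty]$), and let $\kappa_d$ be the volume of the unit ball of $\mathbb{R}^d$. Then for all real numbers $$\alpha<\frac13\left(\frac{s}{d\kappa_d(1-\varepsilon)}\right)^{1/d},\qquad \beta>\left(\frac{s}{d\kappa_d\,\varepsilon}\right)^{1/d},$$ one has, as $\lambda\to\infty$, $$\mathbb{P}\left(\alpha\le\frac{d_H(K,K_{\chi_\lambda})}{(\lambda^{-1}\ln\lambda)^{1/d}}\le\beta\right)\to1\qquad\text{and}\qquad \mathbb{P}\left(\alpha\le\frac{d_H(\partial K,\partial K_{\chi_\lambda})}{(\lambda^{-1}\ln\lambda)^{1/d}}\le\beta\right)\to1.$$ -/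

import Mathlib

open MeasureTheory ProbabilityTheory Filter Topology Set
open scoped ENNReal NNReal Pointwise

noncomputable section

/-- The `s`-dimensional lower Minkowski content of `E ⊆ ℝ^d`:
`liminf_{r → 0+} Vol(E + B(0,r)) / r^(d-s)`. -/
def lowerMinkowskiContent {d : ℕ} (s : ℝ) (E : Set (EuclideanSpace ℝ (Fin d))) : ℝ≥0∞ :=
  liminf (fun r : ℝ => volume (E + Metric.ball (0 : EuclideanSpace ℝ (Fin d)) r) /
    ENNReal.ofReal (r ^ ((d : ℝ) - s))) (𝓝[>] 0)

/-- The `s`-dimensional upper Minkowski content of `E ⊆ ℝ^d`: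
`limsup_{r → 0+} Vol(E + B(0,r)) / r^(d-s)`. -/
def upperMinkowskiContent {d : ℕ} (s : ℝ) (E : Set (EuclideanSpace ℝ (Fin d))) : ℝ≥0∞ :=
  limsup (fun r : ℝ => volume (E + Metric.ball (0 : EuclideanSpace ℝ (Fin d)) r) /
    ENNReal.ofReal (r ^ ((d : ℝ) - s))) (𝓝[>] 0)

/-- `E` has (finite and positive) `s`-dimensional upper and lower Minkowski contents;
`s` is then necessarily the Minkowski dimension of `E`. -/
structure HasMinkowskiContents {d : ℕ} (s : ℝ) (E : Set (EuclideanSpace ℝ (Fin d))) : Prop where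
  lower_pos : 0 < lowerMinkowskiContent s E
  lower_lt_top : lowerMinkowskiContent s E < ∞
  upper_pos : 0 < upperMinkowskiContent s E
  upper_lt_top : upperMinkowskiContent s E < ∞

/-- The density of `A` at radius `r` in `x`: `Vol(A ∩ B(x,r)) / Vol(B(x,r))`. -/
def densityAt {d : ℕ} (A : Set (EuclideanSpace ℝ (Fin d))) (r : ℝ)
    (x : EuclideanSpace ℝ (Fin d)) : ℝ :=
  volume.real (A ∩ Metric.ball x r) / volume.real (Metric.ball x r)

/-- `K` is bi-standard with constant `ε`: for all small enough `r > 0`, the density of `K` at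
radius `r` is at least `ε` on `K`, and that of `Kᶜ` is at least `ε` on `Kᶜ`. -/
def IsBiStandard {d : ℕ} (ε : ℝ) (K : Set (EuclideanSpace ℝ (Fin d))) : Prop :=
  ∀ᶠ r in 𝓝[>] (0 : ℝ),
    (∀ x ∈ K, ε ≤ densityAt K r x) ∧ (∀ x ∈ Kᶜ, ε ≤ densityAt Kᶜ r x)

/-- The volume `κ_d` of the unit ball of `ℝ^d`. -/
def unitBallVolume (d : ℕ) : ℝ :=
  volume.real (Metric.ball (0 : EuclideanSpace ℝ (Fin d)) 1)

/-- The Voronoi cell of nucleus `x` with respect to `χ`. -/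
def voronoiCell {d : ℕ} (χ : Set (EuclideanSpace ℝ (Fin d))) (x : EuclideanSpace ℝ (Fin d)) :
    Set (EuclideanSpace ℝ (Fin d)) :=
  {y | ∀ x' ∈ χ, dist y x ≤ dist y x'}

/-- The Voronoi approximation `K_χ` of `K`: the union of the Voronoi cells (with respect to `χ`)
whose nuclei are the points of `χ` in `K`. -/
def voronoiApprox {d : ℕ} (K χ : Set (EuclideanSpace ℝ (Fin d))) :
    Set (EuclideanSpace ℝ (Fin d)) :=
  ⋃ x ∈ χ ∩ K, voronoiCell χ x

/-- The random set `χ`, defined on the space `(Ω, P)`, is a homogeneous Poisson point process of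
intensity `l` on `ℝ^d`: it is locally finite, the number of its points in a bounded measurable set
`A` has the Poisson law of parameter `l * Vol(A)`, and the numbers of its points in pairwise
disjoint bounded measurable sets are independent. -/
structure IsPoissonProcess {d : ℕ} {Ω : Type*} [MeasurableSpace Ω]
    (χ : Ω → Set (EuclideanSpace ℝ (Fin d))) (l : ℝ) (P : Measure Ω) : Prop where
  locallyFinite : ∀ ω, ∀ A : Set (EuclideanSpace ℝ (Fin d)), Bornology.IsBounded A →
    (χ ω ∩ A).Finite
  hasLaw_count : ∀ A : Set (EuclideanSpace ℝ (Fin d)), MeasurableSet A → Bornology.IsBounded A →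
    HasLaw (fun ω => (χ ω ∩ A).ncard) (poissonMeasure (l * volume.real A).toNNReal) P
  iIndepFun_count : ∀ (n : ℕ) (A : Fin n → Set (EuclideanSpace ℝ (Fin d))),
    (∀ i, MeasurableSet (A i)) → (∀ i, Bornology.IsBounded (A i)) →
    Pairwise (fun i j => Disjoint (A i) (A j)) →
    iIndepFun (fun i ω => (χ ω ∩ A i).ncard) P

/-- The ratio of the Hausdorff distance between `A` and `B` to `(l⁻¹ ln l)^(1/d)`, with values in
`[0, ∞]` (the Hausdorff distance is infinite if, say, just one of the two sets is empty). -/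
def hausdorffRatio {d : ℕ} (l : ℝ) (A B : Set (EuclideanSpace ℝ (Fin d))) : ℝ≥0∞ :=
  Metric.hausdorffEDist A B / ENNReal.ofReal ((l⁻¹ * Real.log l) ^ (1 / (d : ℝ)))

end

/-!
Write `g = (l⁻¹ log l) ^ (1 / d)`, so that `l * g ^ d = log l`. A region of volume `v * g ^ d` is
free of points of the Poisson process with probability `l ^ (-v)`, while the Minkowski contents say
that the number of balls of radius of order `g` needed near the boundary is of order `g ^ (-s)`,
that is `(l / log l) ^ (s / d)`. Both bounds compare these two orders of magnitude.

For the upper bound, a large Hausdorff distance is only possible if there is a *void*: a ball of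
radius `R = γ g` centred at a point `y` of `A = K` or `A = Kᶜ`, close to the boundary, such that
`A ∩ B(y, R)` has no points of the process (`hausdorffEDist_voronoiApprox_le`,
`hausdorffEDist_frontier_voronoiApprox_le`). A misclassified point far from the boundary is
the centre of a large empty ball contained in `A`, and such a ball contains a smaller one close to
the boundary (`hasVoid_of_mem_closure_voronoiApprox_compl`); therefore only the neighbourhood of
the boundary matters. By bi-standardness the volume of `A ∩ B(y, R)` is at least
`ε * κ_d * R ^ d`, and a union bound over a net shows that voids are unlikely
(`tendsto_measure_hasVoid`).

For the lower bound, let `x` be a boundary point, and suppose that `K ∩ B(x, 3R)` has no points of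
the process but `Kᶜ ∩ B(x, R)` has one. Then points of `B(x, R)` are closer to a nucleus outside
`K` than to any nucleus in `K`, so `B(x, R)` misses the Voronoi approximation
(`disjoint_ball_voronoiApprox`). The volume of `K ∩ B(x, 3R)` is at most
`(1 - ε) * κ_d * (3R) ^ d`, since both densities are at least `ε` at boundary points. Among
the order of `g ^ (-s)` boundary points at mutual distance `6R` these events are independent, so one
of them occurs with probability tending to one (`tendsto_measure_forall_not_isIsolated`).
-/

/-! ### Voids near the boundary and the upper bound -/

/-- `χ` leaves a void of radius `R` in `A`: some `y ∈ A` within distance `2 * R` of the boundary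
of `A` has no point of `χ ∩ A` in its open `R`-ball. The factor `2` leaves room for limiting
arguments; it only affects the constant in the number of balls needed to detect voids. -/
def HasVoid {d : ℕ} (χ A : Set (EuclideanSpace ℝ (Fin d))) (R : ℝ) : Prop :=
  ∃ y ∈ A, Metric.infDist y (frontier A) ≤ 2 * R ∧ χ ∩ (A ∩ Metric.ball y R) = ∅

theorem exists_frontier_mem_ball {d : ℕ} {A : Set (EuclideanSpace ℝ (Fin d))}
    {x p q : EuclideanSpace ℝ (Fin d)} {r : ℝ} (hp : p ∈ A) (hpx : p ∈ Metric.ball x r)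
    (hq : q ∉ A) (hqx : q ∈ Metric.ball x r) : ∃ z ∈ frontier A, z ∈ Metric.ball x r := by
  by_contra! hno
  have hsub : Metric.ball x r ⊆ interior A ∪ interior Aᶜ := by
    intro z hz
    by_contra hz'
    refine hno z ?_ hz
    rw [frontier_eq_closure_inter_closure, ← compl_compl (closure A), ← interior_compl,
      ← compl_compl (closure Aᶜ), ← interior_compl, compl_compl]
    rw [mem_union, not_or] at hz'
    exact ⟨hz'.2, hz'.1⟩
  obtain ⟨z, -, hz1, hz2⟩ := (convex_ball x r).isPreconnected _ _ isOpen_interior isOpen_interior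
    hsub ⟨p, hpx, (hsub hpx).resolve_right fun h => interior_subset h hp⟩
    ⟨q, hqx, (hsub hqx).resolve_left fun h => hq (interior_subset h)⟩
  exact interior_subset hz2 (interior_subset hz1)

theorem ball_subset_of_le_infDist_frontier {d : ℕ} {A : Set (EuclideanSpace ℝ (Fin d))}
    {x : EuclideanSpace ℝ (Fin d)} (hx : x ∈ A) {D : ℝ}
    (hD : D ≤ Metric.infDist x (frontier A)) : Metric.ball x D ⊆ A := by
  intro y hy
  by_contra hyA
  have h0 : 0 < D := Metric.pos_of_mem_ball hy
  obtain ⟨z, hzA, hz⟩ := exists_frontier_mem_ball hx (Metric.mem_ball_self h0) hyA hy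
  have := Metric.infDist_le_dist_of_mem (x := x) hzA
  rw [Metric.mem_ball, dist_comm] at hz
  linarith

/-- An empty ball deep inside `A` can be slid, along a segment to a nearest boundary point,
to an empty ball close to the boundary. -/
theorem hasVoid_of_inter_ball_eq_empty {d : ℕ} {χ A : Set (EuclideanSpace ℝ (Fin d))}
    {x : EuclideanSpace ℝ (Fin d)} {R ρ : ℝ} (hR : 0 < R) (hx : x ∈ A) (hRρ : R ≤ ρ)
    (hρ : Metric.infDist x (frontier A) - ρ ≤ R) (hχ : χ ∩ Metric.ball x ρ = ∅)
    (hne : (frontier A).Nonempty) : HasVoid χ A R := by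
  have key : ∀ y, dist y x ≤ ρ - R → χ ∩ (A ∩ Metric.ball y R) = ∅ := by
    intro y hy
    refine subset_empty_iff.1 (hχ ▸ inter_subset_inter_right χ (inter_subset_right.trans ?_))
    exact Metric.ball_subset_ball' (by linarith)
  rcases le_or_gt (Metric.infDist x (frontier A)) (2 * R) with h | h
  · exact ⟨x, hx, h, key x (by simpa using hRρ)⟩
  · set D := Metric.infDist x (frontier A) with hDdef
    -- the point of the segment from `x` to a nearest boundary point `z` at distance `2 * R` from `z`
    obtain ⟨z, hz, hxz⟩ := isClosed_frontier.exists_infDist_eq_dist hne x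
    rw [← hDdef] at hxz
    have hD : 0 < D := by linarith
    have ht0 : 0 ≤ 2 * R / D := by positivity
    have ht1 : 2 * R / D ≤ 1 := (div_le_one hD).2 h.le
    have hyz : dist (AffineMap.lineMap z x (2 * R / D)) z = 2 * R := by
      rw [dist_lineMap_left, dist_comm z x, ← hxz, Real.norm_of_nonneg ht0,
        div_mul_cancel₀ _ hD.ne']
    have hyx : dist (AffineMap.lineMap z x (2 * R / D)) x = D - 2 * R := by
      rw [dist_lineMap_right, dist_comm z x, ← hxz, Real.norm_of_nonneg (by linarith), sub_mul,
        div_mul_cancel₀ _ hD.ne', one_mul]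
    refine ⟨AffineMap.lineMap z x (2 * R / D), ?_, ?_, key _ (by linarith)⟩
    · exact ball_subset_of_le_infDist_frontier hx le_rfl
        (Metric.mem_ball.2 (by rw [hyx, ← hDdef]; linarith))
    · exact (Metric.infDist_le_dist_of_mem hz).trans hyz.le

/-- A point of `A` far from the boundary which is a limit of points with a nearest nucleus
outside `A` is the centre of a large empty ball, whence a void. -/
theorem hasVoid_of_mem_closure_voronoiApprox_compl {d : ℕ}
    {χ A : Set (EuclideanSpace ℝ (Fin d))} {x : EuclideanSpace ℝ (Fin d)} {R : ℝ} (hR : 0 < R)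
    (hx : x ∈ A) (hfar : R < Metric.infDist x (frontier A))
    (hcl : x ∈ closure (voronoiApprox Aᶜ χ)) : HasVoid χ A R := by
  have hne : (frontier A).Nonempty := by
    by_contra h
    rw [not_nonempty_iff_eq_empty] at h
    rw [h, Metric.infDist_empty] at hfar
    linarith
  set D := Metric.infDist x (frontier A) with hD
  set η := min ((D - R) / 2) (R / 2) with hη
  have hη0 : 0 < η := lt_min (by linarith) (by linarith)
  have hη1 : η ≤ (D - R) / 2 := min_le_left _ _
  have hη2 : η ≤ R / 2 := min_le_right _ _
  -- the nearest nucleus of `x'` lies outside the ball `B(x, D) ⊆ A`, hence at distance at least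
  -- `D - η` from `x'`, so that no nucleus is closer than `D - 2 * η` to `x`
  obtain ⟨x', hx', hxx'⟩ := Metric.mem_closure_iff.1 hcl η hη0
  simp only [voronoiApprox, voronoiCell, mem_iUnion, mem_ofPred_eq] at hx'
  obtain ⟨q, ⟨-, hqA⟩, hq⟩ := hx'
  have hxq : D ≤ dist q x := by
    by_contra! h
    exact hqA (ball_subset_of_le_infDist_frontier hx le_rfl (Metric.mem_ball.2 h))
  refine hasVoid_of_inter_ball_eq_empty (ρ := D - 2 * η) hR hx (by linarith) (by linarith) ?_ hne
  rw [eq_empty_iff_forall_notMem]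
  rintro p ⟨hp, hpx⟩
  have h1 := hq p hp
  rw [Metric.mem_ball, dist_comm] at hpx
  have h2 := dist_triangle x' x p
  have h3 := dist_triangle x x' q
  rw [dist_comm q x] at hxq
  rw [dist_comm x' x] at h2
  linarith

theorem exists_nearest_nucleus {d : ℕ} {χ : Set (EuclideanSpace ℝ (Fin d))}
    (hfin : ∀ A : Set (EuclideanSpace ℝ (Fin d)), Bornology.IsBounded A → (χ ∩ A).Finite)
    (hne : χ.Nonempty) (x : EuclideanSpace ℝ (Fin d)) :
    ∃ q ∈ χ, ∀ q' ∈ χ, dist x q ≤ dist x q' := by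
  obtain ⟨p, hp⟩ := hne
  obtain ⟨q, hq, hmin⟩ := (hfin _ (Metric.isBounded_closedBall (x := x)
    (r := dist p x))).exists_minimalFor (fun q => dist x q) _ ⟨p, hp, Metric.mem_closedBall.2 le_rfl⟩
  refine ⟨q, hq.1, fun q' hq' => ?_⟩
  by_cases h : q' ∈ Metric.closedBall x (dist p x)
  · rcases le_total (dist x q) (dist x q') with h' | h'
    · exact h'
    · exact hmin ⟨hq', h⟩ h'
  · have h1 := hq.2
    rw [Metric.mem_closedBall, dist_comm] at h1 h
    linarith

theorem compl_voronoiApprox_subset {d : ℕ} {χ : Set (EuclideanSpace ℝ (Fin d))}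
    (hfin : ∀ A : Set (EuclideanSpace ℝ (Fin d)), Bornology.IsBounded A → (χ ∩ A).Finite)
    (hne : χ.Nonempty) (K : Set (EuclideanSpace ℝ (Fin d))) :
    (voronoiApprox K χ)ᶜ ⊆ voronoiApprox Kᶜ χ := by
  intro x hx
  obtain ⟨q, hq, hmin⟩ := exists_nearest_nucleus hfin hne x
  refine mem_biUnion (show q ∈ χ ∩ Kᶜ from ⟨hq, fun hqK => hx ?_⟩) hmin
  exact mem_biUnion (show q ∈ χ ∩ K from ⟨hq, hqK⟩) hmin

theorem nucleus_mem_voronoiApprox_iff {d : ℕ} {K χ : Set (EuclideanSpace ℝ (Fin d))}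
    {q : EuclideanSpace ℝ (Fin d)} (hq : q ∈ χ) : q ∈ voronoiApprox K χ ↔ q ∈ K := by
  constructor
  · intro h
    simp only [voronoiApprox, voronoiCell, mem_iUnion, mem_ofPred_eq] at h
    obtain ⟨p, ⟨-, hpK⟩, hp⟩ := h
    have := hp q hq
    rw [dist_self] at this
    rwa [dist_le_zero.1 this]
  · intro h
    exact mem_biUnion (show q ∈ χ ∩ K from ⟨hq, h⟩) fun p _ => by simp

section NoVoid

variable {d : ℕ} {K χ : Set (EuclideanSpace ℝ (Fin d))} {R R' : ℝ}

theorem exists_nucleus_of_not_hasVoid {A : Set (EuclideanSpace ℝ (Fin d))}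
    (hA : ¬ HasVoid χ A R) {x : EuclideanSpace ℝ (Fin d)} (hx : x ∈ A)
    (hxf : Metric.infDist x (frontier A) ≤ 2 * R) : ∃ q ∈ χ, q ∈ A ∧ dist q x < R := by
  by_contra! h
  refine hA ⟨x, hx, hxf, eq_empty_iff_forall_notMem.2 ?_⟩
  rintro q ⟨hq, hqA, hqx⟩
  exact absurd (h q hq hqA) (not_le.2 hqx)

theorem nonempty_of_not_hasVoid (hKc : IsClosed K) (hF : (frontier K).Nonempty) (hR : 0 < R)
    (hK : ¬ HasVoid χ K R) : χ.Nonempty := by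
  obtain ⟨z, hz⟩ := hF
  obtain ⟨q, hq, -⟩ := exists_nucleus_of_not_hasVoid hK (hKc.frontier_subset hz)
    (by rw [Metric.infDist_zero_of_mem hz]; linarith)
  exact ⟨q, hq⟩

/-- Without voids on either side, the Voronoi approximation is Hausdorff close to `K`. -/
theorem hausdorffEDist_voronoiApprox_le (hKc : IsClosed K) (hF : (frontier K).Nonempty)
    (hfin : ∀ A : Set (EuclideanSpace ℝ (Fin d)), Bornology.IsBounded A → (χ ∩ A).Finite)
    (hR : 0 < R) (hK : ¬ HasVoid χ K R) (hKc' : ¬ HasVoid χ Kᶜ R) :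
    Metric.hausdorffEDist K (voronoiApprox K χ) ≤ ENNReal.ofReal R := by
  have hFK : frontier K ⊆ K := hKc.frontier_subset
  have hne : χ.Nonempty := nonempty_of_not_hasVoid hKc hF hR hK
  refine Metric.hausdorffEDist_le_of_mem_edist (fun x hx => ?_) fun x hx => ?_
  · rcases le_or_gt (Metric.infDist x (frontier K)) R with h | h
    · obtain ⟨q, hq, hqK, hqx⟩ := exists_nucleus_of_not_hasVoid hK hx (by linarith)
      refine ⟨q, (nucleus_mem_voronoiApprox_iff hq).2 hqK, ?_⟩
      rw [edist_dist, dist_comm]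
      exact ENNReal.ofReal_le_ofReal hqx.le
    · refine ⟨x, ?_, by simp⟩
      by_contra hx'
      exact hK (hasVoid_of_mem_closure_voronoiApprox_compl hR hx h
        (subset_closure (compl_voronoiApprox_subset hfin hne K hx')))
  · by_cases hxK : x ∈ K
    · exact ⟨x, hxK, by simp⟩
    · rcases le_or_gt (Metric.infDist x (frontier K)) R with h | h
      · obtain ⟨z, hz, hxz⟩ := isClosed_frontier.exists_infDist_eq_dist hF x
        refine ⟨z, hFK hz, ?_⟩
        rw [edist_dist]
        exact ENNReal.ofReal_le_ofReal (hxz ▸ h)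
      · refine absurd (hasVoid_of_mem_closure_voronoiApprox_compl (A := Kᶜ) hR hxK ?_ ?_) hKc'
        · rwa [frontier_compl]
        · rw [compl_compl]
          exact subset_closure hx

/-- Without voids on either side, the boundary of the Voronoi approximation is Hausdorff close
to that of `K`. -/
theorem hausdorffEDist_frontier_voronoiApprox_le (hKc : IsClosed K) (hF : (frontier K).Nonempty)
    (hfin : ∀ A : Set (EuclideanSpace ℝ (Fin d)), Bornology.IsBounded A → (χ ∩ A).Finite)
    (hR : 0 < R) (hRR' : R < R') (hK : ¬ HasVoid χ K R) (hKc' : ¬ HasVoid χ Kᶜ R) :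
    Metric.hausdorffEDist (frontier K) (frontier (voronoiApprox K χ)) ≤ ENNReal.ofReal R' := by
  have hFK : frontier K ⊆ K := hKc.frontier_subset
  have hne : χ.Nonempty := nonempty_of_not_hasVoid hKc hF hR hK
  refine Metric.hausdorffEDist_le_of_mem_edist (fun x hx => ?_) fun x hx => ?_
  · obtain ⟨q, hq, hqK, hqx⟩ := exists_nucleus_of_not_hasVoid hK (hFK hx)
      (by rw [Metric.infDist_zero_of_mem hx]; linarith)
    -- `x` is only a limit of points of `Kᶜ`, which costs the difference between `R` and `R'`
    obtain ⟨x', hx', hxx'⟩ := Metric.mem_closure_iff.1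
      (frontier_eq_closure_inter_closure.le hx).2 (min R (R' - R)) (lt_min hR (by linarith))
    have hxx1 := hxx'.trans_le (min_le_left _ _)
    have hxx2 := hxx'.trans_le (min_le_right _ _)
    obtain ⟨p, hp, hpK, hpx⟩ := exists_nucleus_of_not_hasVoid hKc' hx' (by
      rw [frontier_compl]
      have := Metric.infDist_le_dist_of_mem (x := x') hx
      rw [dist_comm] at this
      linarith)
    obtain ⟨z, hz, hzx⟩ := exists_frontier_mem_ball (A := voronoiApprox K χ) (x := x) (r := R')
      ((nucleus_mem_voronoiApprox_iff hq).2 hqK) (Metric.mem_ball.2 (by linarith))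
      (fun h => hpK ((nucleus_mem_voronoiApprox_iff hp).1 h))
      (Metric.mem_ball.2 (by have := dist_triangle p x' x; rw [dist_comm x' x] at this; linarith))
    refine ⟨z, hz, ?_⟩
    rw [edist_dist, dist_comm]
    exact ENNReal.ofReal_le_ofReal (Metric.mem_ball.1 hzx).le
  · rw [frontier_eq_closure_inter_closure] at hx
    have h : Metric.infDist x (frontier K) ≤ R := by
      by_contra! h
      by_cases hxK : x ∈ K
      · exact hK (hasVoid_of_mem_closure_voronoiApprox_compl hR hxK h
          (closure_mono (compl_voronoiApprox_subset hfin hne K) hx.2))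
      · refine absurd (hasVoid_of_mem_closure_voronoiApprox_compl (A := Kᶜ) hR hxK ?_ ?_) hKc'
        · rwa [frontier_compl]
        · rw [compl_compl]
          exact hx.1
    obtain ⟨z, hz, hxz⟩ := isClosed_frontier.exists_infDist_eq_dist hF x
    refine ⟨z, hz, ?_⟩
    rw [edist_dist]
    exact ENNReal.ofReal_le_ofReal (by linarith)

end NoVoid

/-! ### Isolating boundary points and the lower bound -/

/-- The ball `B(x, R)` around a boundary point is isolated: no nucleus of `K` lies in `B(x, 3R)`,
whereas a nucleus of the complement lies in `B(x, R)`. Then `B(x, R)` misses the Voronoi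
approximation, see `disjoint_ball_voronoiApprox`. -/
def IsIsolated {d : ℕ} (χ K : Set (EuclideanSpace ℝ (Fin d))) (R : ℝ)
    (x : EuclideanSpace ℝ (Fin d)) : Prop :=
  χ ∩ (K ∩ Metric.ball x (3 * R)) = ∅ ∧ (χ ∩ (Kᶜ ∩ Metric.ball x R)).Nonempty

section Isolated

variable {d : ℕ} {K χ : Set (EuclideanSpace ℝ (Fin d))} {R : ℝ} {x : EuclideanSpace ℝ (Fin d)}

theorem disjoint_ball_voronoiApprox (h : IsIsolated χ K R x) :
    Disjoint (Metric.ball x R) (voronoiApprox K χ) := by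
  rw [Set.disjoint_left]
  intro y hy hyK
  simp only [voronoiApprox, voronoiCell, mem_iUnion, mem_ofPred_eq] at hyK
  obtain ⟨q, ⟨hqχ, hqK⟩, hq⟩ := hyK
  obtain ⟨hempty, p, hp, -, hpx⟩ := h
  have h1 : 3 * R ≤ dist q x := by
    by_contra! h'
    exact (hempty.le ⟨hqχ, hqK, h'⟩ : q ∈ (∅ : Set _))
  have h2 := hq p hp
  rw [Metric.mem_ball] at hy hpx
  have h3 := dist_triangle q y x
  have h4 := dist_triangle y x p
  rw [dist_comm q y] at h3
  rw [dist_comm x p] at h4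
  linarith

theorem le_infEDist_of_disjoint_ball {S : Set (EuclideanSpace ℝ (Fin d))}
    (h : Disjoint (Metric.ball x R) S) : ENNReal.ofReal R ≤ Metric.infEDist x S := by
  refine Metric.le_infEDist.2 fun y hy => ?_
  rw [edist_dist]
  refine ENNReal.ofReal_le_ofReal ?_
  by_contra! h'
  exact Set.disjoint_left.1 h (Metric.mem_ball'.2 h') hy

theorem le_hausdorffEDist_voronoiApprox (hx : x ∈ K) (h : IsIsolated χ K R x) :
    ENNReal.ofReal R ≤ Metric.hausdorffEDist K (voronoiApprox K χ) :=
  (le_infEDist_of_disjoint_ball (disjoint_ball_voronoiApprox h)).trans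
    (Metric.infEDist_le_hausdorffEDist_of_mem hx)

theorem le_hausdorffEDist_frontier_voronoiApprox (hx : x ∈ frontier K)
    (h : IsIsolated χ K R x) :
    ENNReal.ofReal R ≤ Metric.hausdorffEDist (frontier K) (frontier (voronoiApprox K χ)) :=
  (le_infEDist_of_disjoint_ball (((disjoint_ball_voronoiApprox h).closure_right
    Metric.isOpen_ball).mono_right frontier_subset_closure)).trans
    (Metric.infEDist_le_hausdorffEDist_of_mem hx)

end Isolated

/-! ### Volumes, densities and packings near the boundary -/

section Volume

variable {d : ℕ} {ε s : ℝ} {A F K S : Set (EuclideanSpace ℝ (Fin d))}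

theorem unitBallVolume_pos (d : ℕ) : 0 < unitBallVolume d :=
  ENNReal.toReal_pos (Metric.measure_ball_pos volume _ one_pos).ne' measure_ball_lt_top.ne

theorem volume_real_ball_eq (x : EuclideanSpace ℝ (Fin d)) {r : ℝ} (hr : 0 < r) :
    volume.real (Metric.ball x r) = unitBallVolume d * r ^ d := by
  rw [measureReal_def, Measure.addHaar_ball_of_pos volume x hr, ENNReal.toReal_mul,
    finrank_euclideanSpace, Fintype.card_fin, ENNReal.toReal_ofReal (by positivity), mul_comm,
    unitBallVolume, measureReal_def]

/-- Lower density bounds on `A` pass to the closure of `A`, in particular to boundary points,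
by continuity in the radius of the volume of balls. -/
theorem eventually_density_on_closure
    (h : ∀ᶠ r in 𝓝[>] (0 : ℝ), ∀ x ∈ A, ε ≤ densityAt A r x) :
    ∀ᶠ r in 𝓝[>] (0 : ℝ), ∀ x ∈ closure A,
      ε * (unitBallVolume d * r ^ d) ≤ volume.real (A ∩ Metric.ball x r) := by
  obtain ⟨r₀, hr₀, hr⟩ := mem_nhdsGT_iff_exists_Ioo_subset.1 h
  filter_upwards [Ioo_mem_nhdsGT hr₀] with r hrr x hx
  have hlt : ∀ r' ∈ Ioo 0 r,
      ε * (unitBallVolume d * r' ^ d) ≤ volume.real (A ∩ Metric.ball x r) := by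
    intro r' hr'
    obtain ⟨y, hy, hxy⟩ := Metric.mem_closure_iff.1 hx (r - r') (by linarith [hr'.2])
    have h1 := hr (show r' ∈ Ioo 0 r₀ from ⟨hr'.1, hr'.2.trans hrr.2⟩) y hy
    have hpos : 0 < unitBallVolume d * r' ^ d :=
      mul_pos (unitBallVolume_pos d) (pow_pos hr'.1 d)
    rw [densityAt, volume_real_ball_eq y hr'.1, le_div_iff₀ hpos] at h1
    refine h1.trans (measureReal_mono (inter_subset_inter_right A ?_)
      ((measure_mono inter_subset_right).trans_lt measure_ball_lt_top).ne)
    exact Metric.ball_subset_ball' (by rw [dist_comm]; linarith)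
  have hcont : Tendsto (fun r' : ℝ => ε * (unitBallVolume d * r' ^ d)) (𝓝[<] r)
      (𝓝 (ε * (unitBallVolume d * r ^ d))) :=
    (Continuous.tendsto (by fun_prop) r).mono_left nhdsWithin_le_nhds
  exact le_of_tendsto hcont (by filter_upwards [Ioo_mem_nhdsLT hrr.1] with r' hr' using hlt r' hr')

theorem volume_real_inter_ball_add_compl (hK : MeasurableSet K) (x : EuclideanSpace ℝ (Fin d))
    {r : ℝ} (hr : 0 < r) :
    volume.real (K ∩ Metric.ball x r) + volume.real (Kᶜ ∩ Metric.ball x r) =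
      unitBallVolume d * r ^ d := by
  rw [← volume_real_ball_eq x hr, inter_comm K, inter_comm Kᶜ, ← sdiff_eq]
  exact measureReal_inter_add_sdiff hK measure_ball_lt_top.ne

/-- A bounded set contains a finite `δ`-separated net of mesh `δ`. -/
theorem exists_finset_separated_cover (hS : Bornology.IsBounded S) {δ : ℝ} (hδ : 0 < δ) :
    ∃ t : Finset (EuclideanSpace ℝ (Fin d)), (t : Set _) ⊆ S ∧
      (∀ x ∈ t, ∀ y ∈ t, x ≠ y → δ ≤ dist x y) ∧ ∀ x ∈ S, ∃ y ∈ t, dist x y ≤ δ := by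
  lift δ to ℝ≥0 using hδ.le
  have hδ' : δ / 2 ≠ 0 := by
    have : (0 : ℝ≥0) < δ := by exact_mod_cast hδ
    positivity
  have hpack : Metric.packingNumber δ S ≠ ⊤ := by
    obtain ⟨N, -, hNfin, hN⟩ := Metric.exists_finite_isCover_of_isCompact_closure hδ'
      hS.isCompact_closure
    have h1 := Metric.packingNumber_two_mul_le_externalCoveringNumber (δ / 2) S
    rw [mul_div_cancel₀ δ two_ne_zero] at h1
    exact ((h1.trans hN.externalCoveringNumber_le_encard).trans_lt hNfin.encard_lt_top).ne
  have hfin : (Metric.maximalSeparatedSet δ S).Finite := by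
    rw [← Set.encard_lt_top_iff, Metric.encard_maximalSeparatedSet hpack]
    exact hpack.lt_top
  refine ⟨hfin.toFinset, by simpa using Metric.maximalSeparatedSet_subset, ?_, ?_⟩
  · intro x hx y hy hxy
    have := Metric.isSeparated_maximalSeparatedSet (hfin.mem_toFinset.1 hx)
      (hfin.mem_toFinset.1 hy) hxy
    change (δ : ℝ≥0∞) < edist x y at this
    rw [edist_nndist, ENNReal.coe_lt_coe] at this
    exact_mod_cast this.le
  · intro x hx
    obtain ⟨y, hy, hxy⟩ := mem_iUnion₂.1
      ((Metric.isCover_maximalSeparatedSet hpack).subset_iUnion_closedBall hx)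
    exact ⟨y, hfin.mem_toFinset.2 hy, hxy⟩

theorem mem_add_ball_zero {x y : EuclideanSpace ℝ (Fin d)} {r : ℝ} (hx : x ∈ F)
    (hxy : dist y x < r) : y ∈ F + Metric.ball (0 : EuclideanSpace ℝ (Fin d)) r :=
  ⟨x, hx, y - x, by rwa [mem_ball_zero_iff, ← dist_eq_norm], by simp⟩

theorem exists_volume_le_of_upperMinkowskiContent_lt_top (h : upperMinkowskiContent s F < ∞) :
    ∃ C : ℝ, 0 ≤ C ∧ ∀ᶠ r in 𝓝[>] (0 : ℝ),
      volume (F + Metric.ball (0 : EuclideanSpace ℝ (Fin d)) r) ≤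
        ENNReal.ofReal (C * r ^ ((d : ℝ) - s)) := by
  obtain ⟨C, hC1, hC2⟩ := ENNReal.lt_iff_exists_nnreal_btwn.1 h
  refine ⟨C, C.2, ?_⟩
  filter_upwards [eventually_lt_of_limsup_lt hC1, self_mem_nhdsWithin] with r hr hr0
  have hpos : 0 < r ^ ((d : ℝ) - s) := Real.rpow_pos_of_pos hr0 _
  rw [ENNReal.ofReal_mul C.coe_nonneg, ENNReal.ofReal_coe_nnreal]
  exact (ENNReal.div_le_iff (by simpa using hpos) ENNReal.ofReal_ne_top).1 hr.le

theorem exists_le_volume_of_lowerMinkowskiContent_pos (h : 0 < lowerMinkowskiContent s F) :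
    ∃ c : ℝ, 0 < c ∧ ∀ᶠ r in 𝓝[>] (0 : ℝ), ENNReal.ofReal (c * r ^ ((d : ℝ) - s)) ≤
      volume (F + Metric.ball (0 : EuclideanSpace ℝ (Fin d)) r) := by
  obtain ⟨c, hc1, hc2⟩ := ENNReal.lt_iff_exists_nnreal_btwn.1 h
  refine ⟨c, by exact_mod_cast hc1, ?_⟩
  filter_upwards [eventually_lt_of_lt_liminf hc2, self_mem_nhdsWithin] with r hr hr0
  have hpos : 0 < r ^ ((d : ℝ) - s) := Real.rpow_pos_of_pos hr0 _
  rw [ENNReal.ofReal_mul c.coe_nonneg, ENNReal.ofReal_coe_nnreal]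
  exact (ENNReal.le_div_iff_mul_le (.inl (by simpa using hpos)) (.inl ENNReal.ofReal_ne_top)).1
    hr.le

theorem nonempty_of_lowerMinkowskiContent_pos (h : 0 < lowerMinkowskiContent s F) :
    F.Nonempty := by
  by_contra hF
  rw [not_nonempty_iff_eq_empty] at hF
  obtain ⟨c, hc, hev⟩ := exists_le_volume_of_lowerMinkowskiContent_pos h
  obtain ⟨r, hr, hr0⟩ := (hev.and self_mem_nhdsWithin).exists
  have : 0 < c * r ^ ((d : ℝ) - s) := mul_pos hc (Real.rpow_pos_of_pos hr0 _)
  rw [hF, empty_add, measure_empty, nonpos_iff_eq_zero, ENNReal.ofReal_eq_zero] at hr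
  linarith

theorem tendsto_const_mul_nhdsGT_zero {a : ℝ} (ha : 0 < a) :
    Tendsto (fun g : ℝ => a * g) (𝓝[>] 0) (𝓝[>] 0) := by
  refine tendsto_nhdsWithin_iff.2 ⟨?_, ?_⟩
  · have : Tendsto (fun g : ℝ => a * g) (𝓝 0) (𝓝 (a * 0)) := Continuous.tendsto (by fun_prop) 0
    rw [mul_zero] at this
    exact this.mono_left nhdsWithin_le_nhds
  · filter_upwards [self_mem_nhdsWithin] with g hg using mul_pos ha hg

/-- A volume comparison: sets within distance of order `g` of `F` have nets of mesh of order `g`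
with `O(g ^ (-s))` points. -/
theorem exists_net_near (hFb : Bornology.IsBounded F) (hF : F.Nonempty)
    (h : upperMinkowskiContent s F < ∞) {a η : ℝ} (ha : 0 < a) (hη : 0 < η) :
    ∃ C : ℝ, ∀ᶠ g in 𝓝[>] (0 : ℝ), ∀ S : Set (EuclideanSpace ℝ (Fin d)),
      (∀ y ∈ S, Metric.infDist y F ≤ a * g) →
      ∃ t : Finset (EuclideanSpace ℝ (Fin d)), (t : Set _) ⊆ S ∧
        (∀ x ∈ S, ∃ y ∈ t, dist x y ≤ η * g) ∧ (t.card : ℝ) ≤ C * g ^ (-s) := by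
  obtain ⟨C, hC0, hC⟩ := exists_volume_le_of_upperMinkowskiContent_lt_top h
  have hκ := unitBallVolume_pos d
  refine ⟨C * (a + η) ^ ((d : ℝ) - s) / (unitBallVolume d * (η / 2) ^ d), ?_⟩
  have haη : 0 < a + η := by linarith
  filter_upwards [(tendsto_const_mul_nhdsGT_zero haη).eventually hC,
    self_mem_nhdsWithin] with g hg hg0 S hS
  have hg0 : 0 < g := hg0
  have hηg : 0 < η * g := mul_pos hη hg0
  have hSb : Bornology.IsBounded S := by
    refine (hFb.cthickening (δ := a * g)).subset fun y hy => ?_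
    rw [Metric.cthickening_eq_preimage_infEDist, mem_preimage, mem_Iic]
    exact (ENNReal.le_ofReal_iff_toReal_le (Metric.infEDist_ne_top hF) (by positivity)).2
      (hS y hy)
  obtain ⟨t, htS, hsep, hcov⟩ := exists_finset_separated_cover hSb hηg
  refine ⟨t, htS, hcov, ?_⟩
  have hdisj : (t : Set (EuclideanSpace ℝ (Fin d))).PairwiseDisjoint
      fun y => Metric.ball y (η * g / 2) := fun x hx y hy hxy =>
    Metric.ball_disjoint_ball (by linarith [hsep x hx y hy hxy])
  have hsub : (⋃ y ∈ t, Metric.ball y (η * g / 2)) ⊆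
      F + Metric.ball (0 : EuclideanSpace ℝ (Fin d)) ((a + η) * g) := by
    refine iUnion₂_subset fun y hy z hz => ?_
    have h1 : Metric.infDist y F < a * g + η * g / 2 := by
      have := hS y (htS hy)
      linarith
    obtain ⟨f, hf, hyf⟩ := (Metric.infDist_lt_iff hF).1 h1
    refine mem_add_ball_zero hf ?_
    have := dist_triangle z y f
    rw [Metric.mem_ball] at hz
    linarith
  have hvol := (measure_mono hsub).trans hg
  rw [measure_biUnion_finset hdisj (fun _ _ => measurableSet_ball)] at hvol
  have hball : ∀ y : EuclideanSpace ℝ (Fin d), volume (Metric.ball y (η * g / 2)) =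
      ENNReal.ofReal (unitBallVolume d * (η * g / 2) ^ d) := fun y => by
    rw [← volume_real_ball_eq y (by positivity), ofReal_measureReal measure_ball_lt_top.ne]
  rw [Finset.sum_congr rfl fun y _ => hball y, Finset.sum_const, nsmul_eq_mul,
    ← ENNReal.ofReal_natCast, ← ENNReal.ofReal_mul (by positivity),
    ENNReal.ofReal_le_ofReal_iff (mul_nonneg hC0 (by positivity)),
    Real.mul_rpow haη.le hg0.le, Real.rpow_sub hg0, Real.rpow_natCast] at hvol
  rw [Real.rpow_neg hg0.le, div_mul_eq_mul_div, le_div_iff₀ (by positivity)]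
  have hgd : 0 < g ^ d := pow_pos hg0 d
  refine le_of_mul_le_mul_right ?_ hgd
  calc (t.card : ℝ) * (unitBallVolume d * (η / 2) ^ d) * g ^ d
      = t.card * (unitBallVolume d * (η * g / 2) ^ d) := by
        rw [show η * g / 2 = η / 2 * g by ring, mul_pow]; ring
    _ ≤ _ := hvol
    _ = _ := by ring

/-- A volume comparison: for `g` small, `F` contains of the order of `g ^ (-s)` points at mutual
distance at least of the order of `g`. -/
theorem exists_separated_subset (hFb : Bornology.IsBounded F)
    (h : 0 < lowerMinkowskiContent s F) {a : ℝ} (ha : 0 < a) :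
    ∃ c : ℝ, 0 < c ∧ ∀ᶠ g in 𝓝[>] (0 : ℝ),
      ∃ t : Finset (EuclideanSpace ℝ (Fin d)), (t : Set _) ⊆ F ∧
        (∀ x ∈ t, ∀ y ∈ t, x ≠ y → a * g ≤ dist x y) ∧ c * g ^ (-s) ≤ t.card := by
  obtain ⟨c, hc0, hc⟩ := exists_le_volume_of_lowerMinkowskiContent_pos h
  have hκ := unitBallVolume_pos d
  refine ⟨c * a ^ ((d : ℝ) - s) / (unitBallVolume d * (2 * a) ^ d), by positivity, ?_⟩
  filter_upwards [(tendsto_const_mul_nhdsGT_zero ha).eventually hc,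
    self_mem_nhdsWithin] with g hg hg0
  have hg0 : 0 < g := hg0
  have hag : 0 < a * g := mul_pos ha hg0
  obtain ⟨t, htF, hsep, hcov⟩ := exists_finset_separated_cover hFb hag
  refine ⟨t, htF, hsep, ?_⟩
  have hsub : F + Metric.ball (0 : EuclideanSpace ℝ (Fin d)) (a * g) ⊆
      ⋃ y ∈ t, Metric.ball y (2 * a * g) := by
    rintro _ ⟨f, hf, v, hv, rfl⟩
    obtain ⟨y, hy, hfy⟩ := hcov f hf
    refine mem_biUnion hy (Metric.mem_ball.2 ?_)
    have := dist_triangle (f + v) f y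
    rw [mem_ball_zero_iff] at hv
    rw [dist_self_add_left] at this
    change dist (f + v) y < _
    linarith
  have hvol := (hg.trans (measure_mono hsub)).trans (measure_biUnion_finset_le _ _)
  have hball : ∀ y : EuclideanSpace ℝ (Fin d), volume (Metric.ball y (2 * a * g)) =
      ENNReal.ofReal (unitBallVolume d * (2 * a * g) ^ d) := fun y => by
    rw [← volume_real_ball_eq y (by positivity), ofReal_measureReal measure_ball_lt_top.ne]
  rw [Finset.sum_congr rfl fun y _ => hball y, Finset.sum_const, nsmul_eq_mul,
    ← ENNReal.ofReal_natCast, ← ENNReal.ofReal_mul (by positivity),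
    ENNReal.ofReal_le_ofReal_iff (by positivity),
    Real.mul_rpow ha.le hg0.le, Real.rpow_sub hg0, Real.rpow_natCast] at hvol
  rw [Real.rpow_neg hg0.le, div_mul_eq_mul_div, div_le_iff₀ (by positivity)]
  have hgd : 0 < g ^ d := pow_pos hg0 d
  refine le_of_mul_le_mul_right ?_ hgd
  calc c * a ^ ((d : ℝ) - s) * (g ^ s)⁻¹ * g ^ d
      = c * (a ^ ((d : ℝ) - s) * (g ^ d / g ^ s)) := by ring
    _ ≤ _ := hvol
    _ = _ := by rw [mul_pow]; ring

end Volume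

/-! ### Void probabilities of the Poisson process -/

section Poisson

variable {d : ℕ} {Ω : Type*} [MeasurableSpace Ω] {P : Measure Ω}

theorem IsPoissonProcess.measure_inter_eq_empty {χ : Ω → Set (EuclideanSpace ℝ (Fin d))} {l : ℝ}
    (hχ : IsPoissonProcess χ l P) (hl : 0 ≤ l) {A : Set (EuclideanSpace ℝ (Fin d))}
    (hA : MeasurableSet A) (hAb : Bornology.IsBounded A) :
    P {ω | χ ω ∩ A = ∅} = ENNReal.ofReal (Real.exp (-(l * volume.real A))) := by
  have h1 : {ω | χ ω ∩ A = ∅} = {ω | (χ ω ∩ A).ncard = 0} := by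
    ext ω
    exact (Set.ncard_eq_zero (hχ.locallyFinite ω A hAb)).symm
  rw [h1, (hχ.hasLaw_count A hA hAb).measure_eq (p := fun n => n = 0) (measurableSet_singleton 0)]
  have h2 : 0 ≤ l * volume.real A := mul_nonneg hl measureReal_nonneg
  rw [ofPred_eq_eq_singleton, poissonMeasure_singleton]
  simp [Real.coe_toNNReal _ h2]

/-- Events depending on disjoint pairs of coordinates of an independent family are independent. -/
theorem measure_forall_pair_eq_prod {ι : Type*} [DecidableEq ι] [IsProbabilityMeasure P]
    {X : ι × Fin 2 → Ω → ℕ} (hX : iIndepFun X P) (hm : ∀ i, AEMeasurable (X i) P)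
    (G : Set (ℕ × ℕ)) (s : Finset ι) :
    P {ω | ∀ i ∈ s, (X (i, 0) ω, X (i, 1) ω) ∈ G} =
      ∏ i ∈ s, P {ω | (X (i, 0) ω, X (i, 1) ω) ∈ G} := by
  induction s using Finset.induction_on with
  | empty => simp
  | insert j s hj ih =>
    rw [Finset.prod_insert hj, ← ih]
    have hdisj : Disjoint (({j} : Finset ι) ×ˢ (Finset.univ : Finset (Fin 2)))
        (s ×ˢ Finset.univ) := by
      rw [Finset.disjoint_product]
      exact .inl (by simpa using hj)
    have hind := hX.indepFun_finset₀ _ _ hdisj hm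
    have h := hind.measure_inter_preimage_eq_mul
      {f | (f ⟨(j, 0), by simp⟩, f ⟨(j, 1), by simp⟩) ∈ G}
      {f | ∀ i : s, (f ⟨(i, 0), by simp⟩, f ⟨(i, 1), by simp⟩) ∈ G}
      (DiscreteMeasurableSpace.forall_measurableSet _)
      (DiscreteMeasurableSpace.forall_measurableSet _)
    have h1 : ∀ Y Z : Set Ω, {ω | ∀ i ∈ insert j s, (X (i, 0) ω, X (i, 1) ω) ∈ G} = Y ∩ Z →
        {ω | (X (j, 0) ω, X (j, 1) ω) ∈ G} = Y →
        {ω | ∀ i ∈ s, (X (i, 0) ω, X (i, 1) ω) ∈ G} = Z → P (Y ∩ Z) = P Y * P Z →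
        P {ω | ∀ i ∈ insert j s, (X (i, 0) ω, X (i, 1) ω) ∈ G} =
          P {ω | (X (j, 0) ω, X (j, 1) ω) ∈ G} *
            P {ω | ∀ i ∈ s, (X (i, 0) ω, X (i, 1) ω) ∈ G} := by
      intro Y Z e1 e2 e3 e4
      rw [e1, e2, e3, e4]
    exact h1 _ _ (by ext ω; simp) rfl (by ext ω; simp) h

theorem one_sub_ofReal_le_exp {p : ℝ} (hp : 0 ≤ p) :
    1 - ENNReal.ofReal p ≤ ENNReal.ofReal (Real.exp (-p)) := by
  rw [← ENNReal.ofReal_one, ← ENNReal.ofReal_sub _ hp]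
  exact ENNReal.ofReal_le_ofReal (by linarith [Real.add_one_le_exp (-p)])

/-- Among `N` disjoint pairs `A i`, `B i`, with overwhelming probability some `A i` is free of
points while `B i` is not, if `N` is large compared with the inverse probability of this event. -/
theorem IsPoissonProcess.measure_forall_not_le [IsProbabilityMeasure P]
    {χ : Ω → Set (EuclideanSpace ℝ (Fin d))} {l : ℝ} (hχ : IsPoissonProcess χ l P) (hl : 0 ≤ l)
    {N : ℕ} {A B : Fin N → Set (EuclideanSpace ℝ (Fin d))}
    (hA : ∀ i, MeasurableSet (A i)) (hB : ∀ i, MeasurableSet (B i))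
    (hAb : ∀ i, Bornology.IsBounded (A i)) (hBb : ∀ i, Bornology.IsBounded (B i))
    (hAB : ∀ i, Disjoint (A i) (B i))
    (hdisj : Pairwise fun i j => Disjoint (A i ∪ B i) (A j ∪ B j)) {a b : ℝ}
    (ha : ∀ i, volume.real (A i) ≤ a) (hb0 : 0 ≤ b) (hb : ∀ i, b ≤ volume.real (B i)) :
    P {ω | ∀ i, ¬(χ ω ∩ A i = ∅ ∧ (χ ω ∩ B i).Nonempty)} ≤
      ENNReal.ofReal (Real.exp (-(N * (Real.exp (-(l * a)) * (1 - Real.exp (-(l * b))))))) := by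
  set C : Fin N × Fin 2 → Set (EuclideanSpace ℝ (Fin d)) := fun p => ![A p.1, B p.1] p.2 with hC
  set X : Fin N × Fin 2 → Ω → ℕ := fun p ω => (χ ω ∩ C p).ncard with hXdef
  have hC0 : ∀ i, C (i, 0) = A i := fun i => rfl
  have hC1 : ∀ i, C (i, 1) = B i := fun i => rfl
  have hCm : ∀ p, MeasurableSet (C p) := by
    rintro ⟨i, j⟩
    fin_cases j
    exacts [hA i, hB i]
  have hCb : ∀ p, Bornology.IsBounded (C p) := by
    rintro ⟨i, j⟩
    fin_cases j
    exacts [hAb i, hBb i]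
  have hCsub : ∀ p, C p ⊆ A p.1 ∪ B p.1 := by
    rintro ⟨i, j⟩
    fin_cases j
    exacts [subset_union_left, subset_union_right]
  have hCd : Pairwise fun p q => Disjoint (C p) (C q) := by
    rintro ⟨i, j⟩ ⟨i', j'⟩ hne
    rcases eq_or_ne i i' with rfl | hii
    · fin_cases j <;> fin_cases j'
      · exact absurd rfl hne
      · exact hAB i
      · exact (hAB i).symm
      · exact absurd rfl hne
    · exact (hdisj hii).mono (hCsub (i, j)) (hCsub (i', j'))
  have hXm : ∀ p, AEMeasurable (X p) P := fun p => (hχ.hasLaw_count _ (hCm p) (hCb p)).aemeasurable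
  have hX : iIndepFun X P := by
    have h := (hχ.iIndepFun_count (N * 2) (fun k => C (finProdFinEquiv.symm k))
      (fun k => hCm _) (fun k => hCb _)
      fun k k' hk => hCd (finProdFinEquiv.symm.injective.ne hk)).precomp
        finProdFinEquiv.injective
    simpa [hXdef] using h
  have hempty : ∀ p, P {ω | X p ω = 0} =
      ENNReal.ofReal (Real.exp (-(l * volume.real (C p)))) := by
    intro p
    rw [← hχ.measure_inter_eq_empty hl (hCm p) (hCb p)]
    congr 1
    ext ω
    exact Set.ncard_eq_zero (hχ.locallyFinite ω _ (hCb p))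
  set G : Set (ℕ × ℕ) := {n | ¬(n.1 = 0 ∧ n.2 ≠ 0)} with hG
  have hset : {ω | ∀ i, ¬(χ ω ∩ A i = ∅ ∧ (χ ω ∩ B i).Nonempty)} =
      {ω | ∀ i ∈ (Finset.univ : Finset (Fin N)), (X (i, 0) ω, X (i, 1) ω) ∈ G} := by
    ext ω
    refine forall_congr' fun i => ?_
    simp only [Finset.mem_univ, forall_const, hG, mem_ofPred_eq, hXdef]
    rw [Set.ncard_eq_zero (hχ.locallyFinite ω _ (hCb _)), Ne,
      Set.ncard_eq_zero (hχ.locallyFinite ω _ (hCb _)), ← not_nonempty_iff_eq_empty (s := _ ∩ C _),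
      ← not_nonempty_iff_eq_empty (s := _ ∩ C _), not_not, hC0, hC1,
      ← not_nonempty_iff_eq_empty]
  have hp0 : 0 ≤ Real.exp (-(l * a)) * (1 - Real.exp (-(l * b))) :=
    mul_nonneg (Real.exp_nonneg _) (sub_nonneg.2 (Real.exp_le_one_iff.2
      (neg_nonpos.2 (mul_nonneg hl hb0))))
  have hsingle : ∀ i, P {ω | (X (i, 0) ω, X (i, 1) ω) ∈ G} ≤
      ENNReal.ofReal (Real.exp (-(Real.exp (-(l * a)) * (1 - Real.exp (-(l * b)))))) := by
    intro i
    have hnull : ∀ p, NullMeasurableSet {ω | X p ω = 0} P := fun p =>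
      (hXm p).nullMeasurable (measurableSet_singleton 0)
    have hcompl : {ω | (X (i, 0) ω, X (i, 1) ω) ∈ G} =
        ({ω | X (i, 0) ω = 0} ∩ {ω | X (i, 1) ω = 0}ᶜ)ᶜ := rfl
    have hind : IndepFun (X (i, 0)) (X (i, 1)) P := hX.indepFun (by simp)
    have hmul : P ({ω | X (i, 0) ω = 0} ∩ {ω | X (i, 1) ω = 0}ᶜ) =
        P {ω | X (i, 0) ω = 0} * P {ω | X (i, 1) ω = 0}ᶜ :=
      hind.measure_inter_preimage_eq_mul {0} {0}ᶜ (measurableSet_singleton 0)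
        (measurableSet_singleton 0).compl
    rw [hcompl, prob_compl_eq_one_sub₀ ((hnull _).inter (hnull _).compl), hmul,
      prob_compl_eq_one_sub₀ (hnull _), hempty, hempty, hC0, hC1]
    refine le_trans (tsub_le_tsub_left ?_ 1) (one_sub_ofReal_le_exp hp0)
    rw [ENNReal.ofReal_mul (Real.exp_nonneg _)]
    refine mul_le_mul' (ENNReal.ofReal_le_ofReal (Real.exp_le_exp.2
      (neg_le_neg (mul_le_mul_of_nonneg_left (ha i) hl)))) ?_
    rw [ENNReal.ofReal_sub _ (Real.exp_nonneg _), ENNReal.ofReal_one]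
    exact tsub_le_tsub_left (ENNReal.ofReal_le_ofReal (Real.exp_le_exp.2
      (neg_le_neg (mul_le_mul_of_nonneg_left (hb i) hl)))) 1
  rw [hset, measure_forall_pair_eq_prod hX hXm]
  refine (Finset.prod_le_prod' fun i _ => hsingle i).trans_eq ?_
  rw [Finset.prod_const, Finset.card_univ, Fintype.card_fin,
    ← ENNReal.ofReal_pow (Real.exp_nonneg _), ← Real.exp_nat_mul, mul_neg]

end Poisson

/-! ### The scale `(l⁻¹ log l) ^ (1 / d)` -/

/-- The scale `(l⁻¹ log l) ^ (1 / d)` of the largest voids of a Poisson process of intensity `l`. -/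
noncomputable def voidScale (d : ℕ) (l : ℝ) : ℝ := (l⁻¹ * Real.log l) ^ (1 / (d : ℝ))

section Scale

variable {d : ℕ} {s c l : ℝ}

theorem voidScale_pos (hl : 1 < l) : 0 < voidScale d l :=
  Real.rpow_pos_of_pos (mul_pos (inv_pos.2 (by linarith)) (Real.log_pos hl)) _

theorem mul_voidScale_pow (hd : d ≠ 0) (hl : 1 < l) : l * voidScale d l ^ d = Real.log l := by
  have h : 0 ≤ l⁻¹ * Real.log l := mul_nonneg (inv_nonneg.2 (by linarith)) (Real.log_pos hl).le
  rw [voidScale, one_div, Real.rpow_inv_natCast_pow h hd, mul_inv_cancel_left₀ (by linarith)]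

theorem tendsto_voidScale (hd : d ≠ 0) : Tendsto (voidScale d) atTop (𝓝[>] 0) := by
  refine tendsto_nhdsWithin_iff.2 ⟨?_, ?_⟩
  · have h1 : Tendsto (fun l : ℝ => l⁻¹ * Real.log l) atTop (𝓝 0) := by
      refine Real.isLittleO_log_id_atTop.tendsto_div_nhds_zero.congr fun l => ?_
      rw [id, div_eq_inv_mul]
    have hd' : (0 : ℝ) < 1 / (d : ℝ) := by positivity
    have h2 := h1.rpow_const (p := 1 / (d : ℝ)) (.inr hd'.le)
    rwa [Real.zero_rpow hd'.ne'] at h2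
  · filter_upwards [eventually_gt_atTop 1] with l hl using voidScale_pos hl

theorem voidScale_rpow_neg (hl : 1 < l) :
    voidScale d l ^ (-s) = l ^ (s / d) * Real.log l ^ (-(s / d)) := by
  have hl0 : 0 < l := by linarith
  rw [voidScale, ← Real.rpow_mul (mul_nonneg (inv_nonneg.2 hl0.le) (Real.log_pos hl).le),
    Real.mul_rpow (inv_nonneg.2 hl0.le) (Real.log_pos hl).le, Real.inv_rpow hl0.le,
    show 1 / (d : ℝ) * -s = -(s / d) by ring, Real.rpow_neg hl0.le, inv_inv]

theorem exp_neg_mul_log (hl : 0 < l) : Real.exp (-(c * Real.log l)) = l ^ (-c) := by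
  rw [Real.rpow_def_of_pos hl]
  ring_nf

theorem tendsto_voidScale_rpow_mul_exp_zero (hs : 0 ≤ s) (hc : s / d < c) :
    Tendsto (fun l => voidScale d l ^ (-s) * Real.exp (-(c * Real.log l))) atTop (𝓝 0) := by
  refine squeeze_zero' ?_ ?_ (tendsto_rpow_neg_atTop (sub_pos.2 hc))
  · filter_upwards [eventually_gt_atTop 1] with l hl
    exact mul_nonneg (Real.rpow_nonneg (voidScale_pos hl).le _) (Real.exp_nonneg _)
  · filter_upwards [eventually_gt_atTop 1, Real.tendsto_log_atTop.eventually_ge_atTop 1]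
      with l hl hlog
    have hl0 : 0 < l := by linarith
    rw [voidScale_rpow_neg hl, exp_neg_mul_log hl0]
    have h1 : Real.log l ^ (-(s / d)) ≤ 1 :=
      Real.rpow_le_one_of_one_le_of_nonpos hlog (neg_nonpos.2 (by positivity))
    calc l ^ (s / d) * Real.log l ^ (-(s / d)) * l ^ (-c)
        ≤ l ^ (s / d) * 1 * l ^ (-c) := by gcongr
      _ = l ^ (-(c - s / d)) := by rw [mul_one, ← Real.rpow_add hl0]; ring_nf

theorem tendsto_voidScale_rpow_mul_exp_atTop (hd : d ≠ 0) (hs : 0 < s) (hc : c < s / d) :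
    Tendsto (fun l => voidScale d l ^ (-s) * Real.exp (-(c * Real.log l))) atTop atTop := by
  have hsd : 0 < s / d := by positivity
  set q := (s / d - c) / (s / d) with hq
  have hq0 : 0 < q := div_pos (sub_pos.2 hc) hsd
  have h1 : Tendsto (fun l : ℝ => (Real.log l / l ^ q)⁻¹) atTop atTop := by
    refine tendsto_inv_nhdsGT_zero.comp (tendsto_nhdsWithin_iff.2
      ⟨(isLittleO_log_rpow_atTop hq0).tendsto_div_nhds_zero, ?_⟩)
    filter_upwards [eventually_gt_atTop 1] with l hl
    exact div_pos (Real.log_pos hl) (Real.rpow_pos_of_pos (by linarith) _)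
  refine ((tendsto_rpow_atTop hsd).comp h1).congr' ?_
  filter_upwards [eventually_gt_atTop 1] with l hl
  have hl0 : 0 < l := by linarith
  have hlog := Real.log_pos hl
  rw [Function.comp, inv_div, Real.div_rpow (Real.rpow_nonneg hl0.le _) hlog.le,
    ← Real.rpow_mul hl0.le, hq, div_mul_cancel₀ _ hsd.ne', voidScale_rpow_neg hl,
    exp_neg_mul_log hl0, Real.rpow_sub hl0, Real.rpow_neg hlog.le, Real.rpow_neg hl0.le]
  ring

end Scale

/-! ### Probabilities of voids and of isolated boundary points -/

section Asymptotics

variable {d : ℕ} {s ε : ℝ} {Ω : ℝ → Type*} [∀ l, MeasurableSpace (Ω l)]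
  {P : ∀ l, Measure (Ω l)} {χ : ∀ l, Ω l → Set (EuclideanSpace ℝ (Fin d))}

/-- The first moment bound: the `O(g ^ (-s))` balls of a net are each empty with probability at
most `l ^ (-c)` with `c > s / d`. -/
theorem tendsto_measure_hasVoid (hd : d ≠ 0) (hs : 0 < s)
    (hχ : ∀ l, 0 < l → IsPoissonProcess (χ l) l (P l))
    {A : Set (EuclideanSpace ℝ (Fin d))} (hA : MeasurableSet A)
    (hFb : Bornology.IsBounded (frontier A)) (hF : (frontier A).Nonempty)
    (hup : upperMinkowskiContent s (frontier A) < ∞)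
    (hdens : ∀ᶠ r in 𝓝[>] (0 : ℝ), ∀ x ∈ A, ε ≤ densityAt A r x)
    {γ' γ : ℝ} (hγ' : 0 < γ') (hγ : γ' < γ) (hc : s / d < ε * (unitBallVolume d * γ' ^ d)) :
    Tendsto (fun l => P l {ω | HasVoid (χ l ω) A (γ * voidScale d l)}) atTop (𝓝 0) := by
  set c := ε * (unitBallVolume d * γ' ^ d) with hcdef
  obtain ⟨C, hC⟩ := exists_net_near hFb hF hup (a := 2 * γ) (η := γ - γ') (by linarith)
    (by linarith)
  have hlim : Tendsto (fun l => ENNReal.ofReal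
      (C * (voidScale d l ^ (-s) * Real.exp (-(c * Real.log l))))) atTop (𝓝 0) := by
    have := ENNReal.tendsto_ofReal
      ((tendsto_voidScale_rpow_mul_exp_zero (d := d) hs.le hc).const_mul C)
    rwa [mul_zero, ENNReal.ofReal_zero] at this
  refine tendsto_of_tendsto_of_tendsto_of_le_of_le' tendsto_const_nhds hlim
    (.of_forall fun _ => zero_le) ?_
  filter_upwards [(tendsto_voidScale hd).eventually hC,
    ((tendsto_const_mul_nhdsGT_zero hγ').comp (tendsto_voidScale hd)).eventually
      (eventually_density_on_closure hdens), eventually_gt_atTop 1] with l hnet hden hl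
  have hl0 : 0 < l := by linarith
  obtain ⟨t, htS, hcov, hcard⟩ := hnet
    {y | y ∈ A ∧ Metric.infDist y (frontier A) ≤ 2 * γ * voidScale d l} fun y hy => hy.2
  set g := voidScale d l with hg
  have hsub : {ω | HasVoid (χ l ω) A (γ * g)} ⊆
      ⋃ y ∈ t, {ω | χ l ω ∩ (A ∩ Metric.ball y (γ' * g)) = ∅} := by
    rintro ω ⟨x, hx, hxF, hempty⟩
    obtain ⟨y, hy, hxy⟩ := hcov x ⟨hx, by linarith⟩
    refine mem_biUnion hy (subset_empty_iff.1 (hempty ▸ ?_))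
    refine inter_subset_inter_right _ (inter_subset_inter_right _
      (Metric.ball_subset_ball' ?_))
    rw [dist_comm]
    linarith
  have hsingle : ∀ y ∈ t, P l {ω | χ l ω ∩ (A ∩ Metric.ball y (γ' * g)) = ∅} ≤
      ENNReal.ofReal (Real.exp (-(c * Real.log l))) := by
    intro y hy
    rw [(hχ l hl0).measure_inter_eq_empty hl0.le (hA.inter measurableSet_ball)
      (Metric.isBounded_ball.subset inter_subset_right)]
    refine ENNReal.ofReal_le_ofReal (Real.exp_le_exp.2 (neg_le_neg ?_))
    calc c * Real.log l = l * (ε * (unitBallVolume d * (γ' * g) ^ d)) := by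
          rw [← mul_voidScale_pow hd hl, hcdef, mul_pow]; ring
      _ ≤ _ := mul_le_mul_of_nonneg_left (hden y (subset_closure (htS hy).1)) hl0.le
  calc P l {ω | HasVoid (χ l ω) A (γ * g)}
      ≤ ∑ y ∈ t, P l {ω | χ l ω ∩ (A ∩ Metric.ball y (γ' * g)) = ∅} :=
        (measure_mono hsub).trans (measure_biUnion_finset_le _ _)
    _ ≤ ∑ y ∈ t, ENNReal.ofReal (Real.exp (-(c * Real.log l))) := Finset.sum_le_sum hsingle
    _ = ENNReal.ofReal (t.card * Real.exp (-(c * Real.log l))) := by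
        rw [Finset.sum_const, nsmul_eq_mul, ENNReal.ofReal_mul (by positivity),
          ENNReal.ofReal_natCast]
    _ ≤ _ := by
        refine ENNReal.ofReal_le_ofReal ?_
        rw [← mul_assoc]
        exact mul_le_mul_of_nonneg_right hcard (Real.exp_nonneg _)

/-- Isolation of a boundary point has probability of order at least `l ^ (-c)` with `c < s / d`,
and there are at least of the order of `g ^ (-s)` boundary points for which these events are
independent. -/
theorem tendsto_measure_forall_not_isIsolated (hd : d ≠ 0) (hs : 0 < s) (hε : 0 < ε)
    [∀ l, IsProbabilityMeasure (P l)] (hχ : ∀ l, 0 < l → IsPoissonProcess (χ l) l (P l))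
    {K : Set (EuclideanSpace ℝ (Fin d))} (hK : IsCompact K)
    (hlow : 0 < lowerMinkowskiContent s (frontier K))
    (hdens : ∀ᶠ r in 𝓝[>] (0 : ℝ), ∀ x ∈ Kᶜ, ε ≤ densityAt Kᶜ r x)
    {α : ℝ} (hα : 0 < α) (hc : (1 - ε) * (unitBallVolume d * (3 * α) ^ d) < s / d) :
    Tendsto (fun l => P l {ω | ∀ x ∈ frontier K, ¬ IsIsolated (χ l ω) K (α * voidScale d l) x})
      atTop (𝓝 0) := by
  have hKm : MeasurableSet K := hK.measurableSet
  have hFK : frontier K ⊆ K := hK.isClosed.frontier_subset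
  have hκ := unitBallVolume_pos d
  set c₁ := (1 - ε) * (unitBallVolume d * (3 * α) ^ d) with hc₁
  set c₂ := ε * (unitBallVolume d * α ^ d) with hc₂
  have hc₂0 : 0 < c₂ := by positivity
  obtain ⟨C, hC0, hC⟩ := exists_separated_subset (hK.isBounded.subset hFK) hlow
    (a := 6 * α) (by linarith)
  have hlim : Tendsto (fun l => ENNReal.ofReal (Real.exp (-(C / 2 *
      (voidScale d l ^ (-s) * Real.exp (-(c₁ * Real.log l))))))) atTop (𝓝 0) := by
    have h1 := (tendsto_voidScale_rpow_mul_exp_atTop hd hs hc).const_mul_atTop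
      (half_pos hC0)
    have h2 := ENNReal.tendsto_ofReal (Real.tendsto_exp_neg_atTop_nhds_zero.comp h1)
    rwa [ENNReal.ofReal_zero] at h2
  have hhalf : ∀ᶠ l in atTop, Real.exp (-(c₂ * Real.log l)) ≤ 1 / 2 :=
    (Real.tendsto_exp_neg_atTop_nhds_zero.comp
      (Real.tendsto_log_atTop.const_mul_atTop hc₂0)).eventually_le_const (by norm_num)
  refine tendsto_of_tendsto_of_tendsto_of_le_of_le' tendsto_const_nhds hlim
    (.of_forall fun _ => zero_le) ?_
  have hdens' := eventually_density_on_closure hdens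
  filter_upwards [(tendsto_voidScale hd).eventually hC,
    ((tendsto_const_mul_nhdsGT_zero hα).comp (tendsto_voidScale hd)).eventually hdens',
    ((tendsto_const_mul_nhdsGT_zero (show 0 < 3 * α by linarith)).comp
      (tendsto_voidScale hd)).eventually hdens', hhalf, eventually_gt_atTop 1]
    with l hsep hden hden3 hhalf hl
  have hl0 : 0 < l := by linarith
  obtain ⟨t, htF, hsep, hcard⟩ := hsep
  set g := voidScale d l with hg
  have hg0 : 0 < g := voidScale_pos hl
  have hFc : ∀ x ∈ t, x ∈ closure Kᶜ := fun x hx =>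
    (frontier_eq_closure_inter_closure.le (htF hx)).2
  set e : Fin t.card ≃ t := t.equivFin.symm with he
  set A : Fin t.card → Set (EuclideanSpace ℝ (Fin d)) :=
    fun i => K ∩ Metric.ball (e i : EuclideanSpace ℝ (Fin d)) (3 * (α * g)) with hA
  set B : Fin t.card → Set (EuclideanSpace ℝ (Fin d)) :=
    fun i => Kᶜ ∩ Metric.ball (e i : EuclideanSpace ℝ (Fin d)) (α * g) with hB
  have hABsub : ∀ i, A i ∪ B i ⊆ Metric.ball (e i : EuclideanSpace ℝ (Fin d)) (3 * (α * g)) :=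
    fun i => union_subset inter_subset_right (inter_subset_right.trans
      (Metric.ball_subset_ball (by nlinarith [mul_pos hα hg0])))
  have hbound := (hχ l hl0).measure_forall_not_le hl0.le (A := A) (B := B)
    (a := (1 - ε) * (unitBallVolume d * (3 * α * g) ^ d))
    (b := ε * (unitBallVolume d * (α * g) ^ d))
    (fun i => hKm.inter measurableSet_ball) (fun i => hKm.compl.inter measurableSet_ball)
    (fun i => Metric.isBounded_ball.subset inter_subset_right)
    (fun i => Metric.isBounded_ball.subset inter_subset_right)
    (fun i => (disjoint_compl_right (a := K)).mono inter_subset_left inter_subset_left)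
    (fun i j hij => by
      refine (Metric.ball_disjoint_ball ?_).mono (hABsub i) (hABsub j)
      have := hsep _ (e i).2 _ (e j).2 fun h => hij (e.injective (Subtype.ext h))
      linarith)
    (fun i => by
      have h1 := volume_real_inter_ball_add_compl hKm (e i) (r := 3 * α * g) (by positivity)
      have h2 := hden3 _ (hFc _ (e i).2)
      simp only [Function.comp] at h2
      rw [hA, ← mul_assoc 3 α g]
      linarith)
    (by positivity) (fun i => hden _ (hFc _ (e i).2))
  have hla : l * ((1 - ε) * (unitBallVolume d * (3 * α * g) ^ d)) = c₁ * Real.log l := by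
    rw [← mul_voidScale_pow hd hl, hc₁, mul_pow (3 * α) g]; ring
  have hlb : l * (ε * (unitBallVolume d * (α * g) ^ d)) = c₂ * Real.log l := by
    rw [← mul_voidScale_pow hd hl, hc₂, mul_pow α g]; ring
  rw [hla, hlb] at hbound
  have hsub : {ω | ∀ x ∈ frontier K, ¬ IsIsolated (χ l ω) K (α * g) x} ⊆
      {ω | ∀ i, ¬(χ l ω ∩ A i = ∅ ∧ (χ l ω ∩ B i).Nonempty)} :=
    fun ω hω i => hω _ (htF (e i).2)
  refine (measure_mono hsub).trans (hbound.trans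
    (ENNReal.ofReal_le_ofReal (Real.exp_le_exp.2 (neg_le_neg ?_))))
  calc C / 2 * (g ^ (-s) * Real.exp (-(c₁ * Real.log l)))
      = C * g ^ (-s) * (Real.exp (-(c₁ * Real.log l)) * (1 / 2)) := by ring
    _ ≤ t.card * (Real.exp (-(c₁ * Real.log l)) * (1 - Real.exp (-(c₂ * Real.log l)))) := by
        gcongr
        linarith

end Asymptotics

/-! ### Convergence in probability of the Hausdorff ratios -/

theorem tendsto_measure_one_of_tendsto_compl {ι : Type*} {f : Filter ι} {Ω : ι → Type*}
    [∀ i, MeasurableSpace (Ω i)] {P : ∀ i, Measure (Ω i)} [∀ i, IsProbabilityMeasure (P i)]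
    {S : ∀ i, Set (Ω i)} (h : Tendsto (fun i => P i (S i)ᶜ) f (𝓝 0)) :
    Tendsto (fun i => P i (S i)) f (𝓝 1) := by
  have h1 : Tendsto (fun i => 1 - P i (S i)ᶜ) f (𝓝 1) := by
    have := ENNReal.Tendsto.sub (tendsto_const_nhds (x := (1 : ℝ≥0∞)) (f := f)) h
      (.inl ENNReal.one_ne_top)
    rwa [tsub_zero] at this
  refine tendsto_of_tendsto_of_tendsto_of_le_of_le h1 tendsto_const_nhds (fun i => ?_)
    fun i => prob_le_one
  rw [tsub_le_iff_right, ← measure_univ (μ := P i), ← union_compl_self (S i)]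
  exact measure_union_le _ _

theorem le_hausdorffRatio {d : ℕ} {l α : ℝ} {A B : Set (EuclideanSpace ℝ (Fin d))} (hl : 1 < l)
    (h : ENNReal.ofReal (α * voidScale d l) ≤ Metric.hausdorffEDist A B) :
    ENNReal.ofReal α ≤ hausdorffRatio l A B := by
  have hg := voidScale_pos (d := d) hl
  rw [hausdorffRatio, ← voidScale, ENNReal.le_div_iff_mul_le (.inl (ENNReal.ofReal_pos.2 hg).ne')
    (.inl ENNReal.ofReal_ne_top)]
  rwa [ENNReal.ofReal_mul' hg.le] at h

theorem hausdorffRatio_le {d : ℕ} {l β : ℝ} {A B : Set (EuclideanSpace ℝ (Fin d))} (hl : 1 < l)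
    (h : Metric.hausdorffEDist A B ≤ ENNReal.ofReal (β * voidScale d l)) :
    hausdorffRatio l A B ≤ ENNReal.ofReal β := by
  have hg := voidScale_pos (d := d) hl
  rw [hausdorffRatio, ← voidScale,
    ENNReal.div_le_iff (ENNReal.ofReal_pos.2 hg).ne' ENNReal.ofReal_ne_top]
  rwa [ENNReal.ofReal_mul' hg.le] at h

theorem ne_zero_of_frontier_nonempty {d : ℕ} {K : Set (EuclideanSpace ℝ (Fin d))}
    (h : (frontier K).Nonempty) : d ≠ 0 := by
  rintro rfl
  have : DiscreteTopology (EuclideanSpace ℝ (Fin 0)) := Subsingleton.discreteTopology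
  rw [(isClopen_discrete K).frontier_eq] at h
  exact not_nonempty_empty h

/-- At a boundary point both densities are at least `ε`, and they sum to `1`. -/
theorem IsBiStandard.lt_one {d : ℕ} {ε : ℝ} {K : Set (EuclideanSpace ℝ (Fin d))}
    (hstd : IsBiStandard ε K) (hε : 0 < ε) (hK : IsClosed K) (hF : (frontier K).Nonempty) :
    ε < 1 := by
  obtain ⟨x, hx⟩ := hF
  obtain ⟨r, ⟨h1, h2⟩, hr⟩ := (((eventually_density_on_closure (hstd.mono fun _ h => h.1)).and
    (eventually_density_on_closure (hstd.mono fun _ h => h.2))).and self_mem_nhdsWithin).exists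
  have hr : 0 < r := hr
  have h3 := volume_real_inter_ball_add_compl hK.measurableSet x hr
  rw [frontier_eq_closure_inter_closure] at hx
  have hpos : 0 < unitBallVolume d * r ^ d := mul_pos (unitBallVolume_pos d) (pow_pos hr d)
  nlinarith [h1 x hx.1, h2 x hx.2]

theorem mul_pow_lt_of_lt_rpow {d : ℕ} (hd : d ≠ 0) {s a x : ℝ} (hs : 0 ≤ s) (ha : 0 < a)
    (hx : 0 ≤ x) (h : x < (s / (d * a)) ^ (1 / (d : ℝ))) : a * x ^ d < s / d := by
  have h1 := pow_lt_pow_left₀ h hx hd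
  rw [one_div, Real.rpow_inv_natCast_pow (by positivity) hd, ← div_div, lt_div_iff₀ ha] at h1
  linarith

theorem lt_mul_pow_of_rpow_lt {d : ℕ} (hd : d ≠ 0) {s a x : ℝ} (hs : 0 ≤ s) (ha : 0 < a)
    (h : (s / (d * a)) ^ (1 / (d : ℝ)) < x) : s / d < a * x ^ d := by
  have h1 := pow_lt_pow_left₀ h (by positivity) hd
  rw [one_div, Real.rpow_inv_natCast_pow (by positivity) hd, ← div_div, div_lt_iff₀ ha] at h1
  linarith

theorem mainTheorem4 {d : ℕ} (K : Set (EuclideanSpace ℝ (Fin d)))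
    (hK : IsCompact K) (hKne : K.Nonempty) (hKvol : 0 < volume K)
    (s : ℝ) (hs : 0 < s) (hcontents : HasMinkowskiContents s (frontier K))
    (ε : ℝ) (hε : 0 < ε) (hstd : IsBiStandard ε K)
    {Ω : ℝ → Type*} [∀ l, MeasurableSpace (Ω l)]
    (P : ∀ l, Measure (Ω l)) [∀ l, IsProbabilityMeasure (P l)]
    (χ : ∀ l, Ω l → Set (EuclideanSpace ℝ (Fin d)))
    (hχ : ∀ l, 0 < l → IsPoissonProcess (χ l) l (P l))
    (α β : ℝ)
    (hα : α < 1 / 3 * (s / (d * unitBallVolume d * (1 - ε))) ^ (1 / (d : ℝ)))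
    (hβ : (s / (d * unitBallVolume d * ε)) ^ (1 / (d : ℝ)) < β) :
    -- the probabilities of the two events tend to 1
    (Tendsto (fun l => P l {ω |
        hausdorffRatio l K (voronoiApprox K (χ l ω)) ∈
          Icc (ENNReal.ofReal α) (ENNReal.ofReal β)}) atTop (𝓝 1) ∧
      Tendsto (fun l => P l {ω |
        hausdorffRatio l (frontier K) (frontier (voronoiApprox K (χ l ω))) ∈
          Icc (ENNReal.ofReal α) (ENNReal.ofReal β)}) atTop (𝓝 1)) ∧
    -- and those of their complements to 0 (for events, this says the same; as `P l` is an outer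
    -- measure on all sets, this makes the claim independent of any measurability question)
    (Tendsto (fun l => P l {ω |
        hausdorffRatio l K (voronoiApprox K (χ l ω)) ∉
          Icc (ENNReal.ofReal α) (ENNReal.ofReal β)}) atTop (𝓝 0) ∧
      Tendsto (fun l => P l {ω |
        hausdorffRatio l (frontier K) (frontier (voronoiApprox K (χ l ω))) ∉
          Icc (ENNReal.ofReal α) (ENNReal.ofReal β)}) atTop (𝓝 0)) := by
  have hF : (frontier K).Nonempty := nonempty_of_lowerMinkowskiContent_pos hcontents.lower_pos
  have hFK : frontier K ⊆ K := hK.isClosed.frontier_subset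
  have hFb : Bornology.IsBounded (frontier K) := hK.isBounded.subset hFK
  have hd : d ≠ 0 := ne_zero_of_frontier_nonempty hF
  have hκ := unitBallVolume_pos d
  have hε1 : ε < 1 := hstd.lt_one hε hK.isClosed hF
  have hβ₀ : 0 ≤ (s / (d * unitBallVolume d * ε)) ^ (1 / (d : ℝ)) := by positivity
  obtain ⟨γ, hγ, hγβ⟩ := exists_between hβ
  obtain ⟨γ', hγ', hγγ⟩ := exists_between hγ
  have hγ'0 : 0 < γ' := hβ₀.trans_lt hγ'
  have hup : s / d < ε * (unitBallVolume d * γ' ^ d) := by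
    rw [mul_assoc] at hγ'
    have := lt_mul_pow_of_rpow_lt hd hs.le (mul_pos hκ hε) hγ'
    linarith
  -- voids are detected with balls of radius `γ' g`, excluded at radius `γ g`, and the boundary
  -- estimate loses the gap between `γ g` and `β g`
  have hvoid := tendsto_measure_hasVoid hd hs hχ hK.measurableSet hFb hF hcontents.upper_lt_top
    (hstd.mono fun _ h => h.1) hγ'0 hγγ hup
  have hvoid' := tendsto_measure_hasVoid hd hs hχ hK.measurableSet.compl
    (by rwa [frontier_compl]) (by rwa [frontier_compl])
    (by rw [frontier_compl]; exact hcontents.upper_lt_top)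
    (hstd.mono fun _ h => h.2) hγ'0 hγγ hup
  -- for `α ≤ 0` the lower bound is trivial, so that the exceptional set may be taken to be empty
  have hiso : Tendsto (fun l => P l {ω | 0 < α ∧
      ∀ x ∈ frontier K, ¬ IsIsolated (χ l ω) K (α * voidScale d l) x}) atTop (𝓝 0) := by
    rcases le_or_gt α 0 with h | h
    · simp [not_lt.2 h]
    · simp only [h, true_and]
      refine tendsto_measure_forall_not_isIsolated hd hs hε hχ hK hcontents.lower_pos
        (hstd.mono fun _ h => h.2) h ?_
      have h3 : 3 * α < (s / (d * (unitBallVolume d * (1 - ε)))) ^ (1 / (d : ℝ)) := by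
        rw [← mul_assoc]
        linarith
      have := mul_pow_lt_of_lt_rpow hd hs.le (mul_pos hκ (sub_pos.2 hε1)) (by linarith) h3
      linarith
  have hsum := (hiso.add hvoid).add hvoid'
  rw [add_zero, add_zero] at hsum
  -- both ratios are controlled by the same exceptional events
  have hbad : ∀ Q : ∀ l, Ω l → ℝ≥0∞,
      (∀ l, 1 < l → ∀ ω, ∀ x ∈ frontier K, IsIsolated (χ l ω) K (α * voidScale d l) x →
        ENNReal.ofReal α ≤ Q l ω) →
      (∀ l, 1 < l → ∀ ω, ¬ HasVoid (χ l ω) K (γ * voidScale d l) →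
        ¬ HasVoid (χ l ω) Kᶜ (γ * voidScale d l) → Q l ω ≤ ENNReal.ofReal β) →
      Tendsto (fun l => P l {ω | Q l ω ∉ Icc (ENNReal.ofReal α) (ENNReal.ofReal β)})
        atTop (𝓝 0) := by
    intro Q hlow hupp
    refine tendsto_of_tendsto_of_tendsto_of_le_of_le' tendsto_const_nhds hsum
      (.of_forall fun _ => zero_le) ?_
    filter_upwards [eventually_gt_atTop 1] with l hl
    refine le_trans (measure_mono fun ω hω => ?_)
      ((measure_union_le _ _).trans (add_le_add_left (measure_union_le _ _) _))
    by_contra hgood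
    simp only [mem_union, mem_ofPred_eq, not_or, not_and, not_forall, not_not] at hgood
    obtain ⟨⟨h1, h2⟩, h3⟩ := hgood
    refine hω ⟨?_, hupp l hl ω h2 h3⟩
    rcases le_or_gt α 0 with h | h
    · rw [ENNReal.ofReal_of_nonpos h]
      exact zero_le
    · obtain ⟨x, hx, hxi⟩ := h1 h
      exact hlow l hl ω x hx hxi
  have hbadK := hbad (fun l ω => hausdorffRatio l K (voronoiApprox K (χ l ω)))
    (fun l hl ω x hx hxi => le_hausdorffRatio hl (le_hausdorffEDist_voronoiApprox (hFK hx) hxi))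
    (fun l hl ω h1 h2 => by
      have hg := voidScale_pos (d := d) hl
      refine hausdorffRatio_le hl ((hausdorffEDist_voronoiApprox_le hK.isClosed hF
        ((hχ l (by linarith)).locallyFinite ω) (mul_pos (by linarith) hg) h1 h2).trans ?_)
      exact ENNReal.ofReal_le_ofReal (mul_le_mul_of_nonneg_right hγβ.le hg.le))
  have hbadF := hbad
    (fun l ω => hausdorffRatio l (frontier K) (frontier (voronoiApprox K (χ l ω))))
    (fun l hl ω x hx hxi =>
      le_hausdorffRatio hl (le_hausdorffEDist_frontier_voronoiApprox hx hxi))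
    (fun l hl ω h1 h2 => by
      have hg := voidScale_pos (d := d) hl
      exact hausdorffRatio_le hl (hausdorffEDist_frontier_voronoiApprox_le hK.isClosed hF
        ((hχ l (by linarith)).locallyFinite ω) (mul_pos (by linarith) hg)
        (mul_lt_mul_of_pos_right hγβ hg) h1 h2))
  exact ⟨⟨tendsto_measure_one_of_tendsto_compl hbadK, tendsto_measure_one_of_tendsto_compl hbadF⟩,
    hbadK, hbadF⟩
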